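/- Let $d\ge 3$. For $x=(x_1,\dots,x_d)\in\mathbb R^d$ put $\Pi(x)=\prod_{i=1}^d|x_i|^{1/d}$ and let $|x|$ denote the Euclidean norm. For a full rank lattice $\Lambda\subset\mathbb R^d$ define its Diophantine exponent $$\omega(\Lambda)=\sup\{\gamma\in\mathbb R : \Pi(x)\le |x|^{-\gamma}\text{ for infinitely many }x\in\Lambda\}\in[-\infty,+\infty],$$ and let $\Omega_d$ be the set of all values $\omega(\Lambda)$, where $\Lambda$ ranges over the full rank lattices in $\mathbb R^d$ of covolume $1$. Then $$\left[\,3-\frac{d}{(d-1)^2}\,,\,+\infty\right]\subset\Omega_d ,$$ that is, every real number $\ge 3-\frac{d}{(d-1)^2}$, and also $+\infty$, is the Diophantine exponent of some lattice of covolume $1$ in $\mathbb R^d$. -/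

import Mathlib

namespace LatticeExponent

/-- The function `Π(x) = ∏ |x_i|^(1/d)` on `ℝ^d`. -/
noncomputable def normProd (d : ℕ) (x : EuclideanSpace ℝ (Fin d)) : ℝ :=
  ∏ i : Fin d, |x i| ^ (1 / (d : ℝ))

/-- The Diophantine exponent
`ω(Λ) = sup {γ ∈ ℝ | Π(x) ≤ |x|^(-γ) for infinitely many x ∈ Λ}`,
as an extended real number; `‖·‖` is the Euclidean norm. -/
noncomputable def exponent {d : ℕ} (Λ : Submodule ℤ (EuclideanSpace ℝ (Fin d))) : EReal :=
  sSup (Real.toEReal ''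
    {γ : ℝ | {x : EuclideanSpace ℝ (Fin d) | x ∈ Λ ∧ normProd d x ≤ ‖x‖ ^ (-γ)}.Infinite})

/-- `Λ` is a full rank lattice of covolume `1` in `ℝ^d`. -/
def IsUnimodularLattice {d : ℕ} (Λ : Submodule ℤ (EuclideanSpace ℝ (Fin d))) : Prop :=
  ∃ _ : DiscreteTopology Λ, IsZLattice ℝ Λ ∧ ZLattice.covolume Λ MeasureTheory.volume = 1

/-- The spectrum `Ω_d` of Diophantine exponents of unimodular lattices in `ℝ^d`. -/
def spectrum (d : ℕ) : Set EReal :=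
  {w | ∃ Λ : Submodule ℤ (EuclideanSpace ℝ (Fin d)), IsUnimodularLattice Λ ∧ exponent Λ = w}

end LatticeExponent

/-! ### From bounds on products of linear forms to exponents of unimodular lattices. -/

namespace LatticeExponent

open MeasureTheory Module

/-! Since `d / (d-1)^2 ≤ 3/4` for `d ≥ 3`, it suffices to realise every real `w ≥ 9/4`, together
with `⊤`; for `⊤` a multiple of `ℤ^d` works. For real `w`, one linear form is modelled on `x_{i₀} -
α x_{i₁}`, where `α` is a lacunary binary series with approximations `|p_k - α q_k| ≍ q_k^(-s)`, `s
= wd + d - 1` (`exists_real_with_approximations`). At `(p_k, q_k, 0, …, 0)` the other `d - 1` forms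
have size about `q_k`, so the product is about `q_k^(-wd)`, which is the order required. All other
points must not do better. The remaining coefficients are perturbed at random: a random form has
mean of `|L(z)|^(-1/2)` at most a multiple of `‖z‖^(-1/2)`, while the form carrying `α` contributes
at most a multiple of `‖z‖`. So `∑ ‖z‖^(-wd/2) ∏ |L_i(z)|^(-1/2)` is finite for some choice once `wd
> d + 3`, and boundedness of its terms is the lower bound sought (`exists_rows_lower_bound`).
Diagonal dominance keeps the forms independent. -/

lemma normProd_eq_rpow (d : ℕ) (x : EuclideanSpace ℝ (Fin d)) :
    normProd d x = (∏ i, |x i|) ^ (1 / (d : ℝ)) := by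
  unfold normProd
  exact Real.finsetProd_rpow _ _ (fun i _ => abs_nonneg _) _

/-- If `∏ |x_i|` is bounded below by a multiple of `‖x‖^(-wd)` on the nonzero points of a discrete
`Λ`, and bounded above by such a multiple infinitely often, then the exponent of `Λ` is `w`. -/
lemma exponent_eq_of_bounds {d : ℕ} (hd : d ≠ 0) (Λ : Submodule ℤ (EuclideanSpace ℝ (Fin d)))
    (hfin : ∀ R : ℝ, {x | x ∈ Λ ∧ ‖x‖ ≤ R}.Finite) (w c C : ℝ) (hc : 0 < c)
    (hlow : ∀ x ∈ Λ, x ≠ 0 → c * ‖x‖ ^ (-(w * d)) ≤ ∏ i, |x i|)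
    (hup : {x | x ∈ Λ ∧ ∏ i, |x i| ≤ C * ‖x‖ ^ (-(w * d))}.Infinite) :
    exponent Λ = (w : EReal) := by
  have hd' : (0 : ℝ) < d := by positivity
  have hpow : ∀ K : ℝ, 0 ≤ K → ∀ x : EuclideanSpace ℝ (Fin d),
      (K * ‖x‖ ^ (-(w * d))) ^ (1 / (d : ℝ)) = K ^ (1 / (d : ℝ)) * ‖x‖ ^ (-w) := by
    intro K hK x
    rw [Real.mul_rpow hK (by positivity), ← Real.rpow_mul (norm_nonneg _)]
    congr 2
    field_simp
  unfold exponent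
  refine le_antisymm (sSup_le ?_) (le_of_forall_lt fun a ha => ?_)
  · rintro _ ⟨γ, hγ, rfl⟩
    rw [EReal.coe_le_coe_iff]
    by_contra! hlt
    set c' := c ^ (1 / (d : ℝ)) with hc'
    have hc'0 : 0 < c' := by positivity
    -- For `γ > w` the two bounds force `‖x‖^(γ-w) ≤ 1/c'`, so only a ball's worth of points
    -- qualifies.
    refine hγ ((hfin ((1 / c') ^ (1 / (γ - w)))).subset ?_)
    rintro x ⟨hx, hle⟩
    refine ⟨hx, ?_⟩
    by_cases h0 : x = 0
    · subst h0; simp only [norm_zero]; positivity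
    have hn : 0 < ‖x‖ := norm_pos_iff.2 h0
    have h1 : c' * ‖x‖ ^ (-w) ≤ ‖x‖ ^ (-γ) := by
      refine le_trans ?_ hle
      rw [normProd_eq_rpow, ← hpow c hc.le]
      exact Real.rpow_le_rpow (by positivity) (hlow x hx h0) (by positivity)
    have h2 : ‖x‖ ^ (γ - w) ≤ 1 / c' := by
      rw [le_div_iff₀ hc'0]
      have : ‖x‖ ^ (γ - w) = ‖x‖ ^ γ * ‖x‖ ^ (-w) := by rw [← Real.rpow_add hn]; ring_nf
      rw [this]
      calc ‖x‖ ^ γ * ‖x‖ ^ (-w) * c' = ‖x‖ ^ γ * (c' * ‖x‖ ^ (-w)) := by ring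
        _ ≤ ‖x‖ ^ γ * ‖x‖ ^ (-γ) := by gcongr
        _ = 1 := by rw [← Real.rpow_add hn]; simp
    calc ‖x‖ = (‖x‖ ^ (γ - w)) ^ (1 / (γ - w)) := by
          rw [← Real.rpow_mul hn.le, mul_one_div_cancel (by linarith), Real.rpow_one]
      _ ≤ _ := Real.rpow_le_rpow (by positivity) h2 (by
          have : 0 < γ - w := by linarith
          positivity)
  · obtain ⟨γ, haγ, hγw⟩ := EReal.lt_iff_exists_real_btwn.1 ha
    rw [EReal.coe_lt_coe_iff] at hγw
    refine lt_of_lt_of_le haγ (le_sSup ⟨γ, ?_, rfl⟩)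
    set C' := (max C 1) ^ (1 / (d : ℝ)) with hC'
    have hC0 : 0 < max C 1 := by positivity
    have hC'0 : 0 < C' := by positivity
    have hδ : 0 < w - γ := by linarith
    -- Outside this ball the factor `‖x‖^(w-γ)` absorbs the constant `C'`.
    refine (hup.sdiff (hfin (max 1 (C' ^ (1 / (w - γ)))))).mono ?_
    rintro x ⟨⟨hx, hle⟩, hbig⟩
    refine ⟨hx, ?_⟩
    have hbig' : max 1 (C' ^ (1 / (w - γ))) < ‖x‖ := by
      by_contra! h
      exact hbig ⟨hx, h⟩
    have hn : 0 < ‖x‖ := lt_of_lt_of_le one_pos ((le_max_left _ _).trans hbig'.le)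
    have h1 : normProd d x ≤ C' * ‖x‖ ^ (-w) := by
      rw [normProd_eq_rpow, hC', ← hpow _ hC0.le]
      refine Real.rpow_le_rpow (Finset.prod_nonneg fun _ _ => abs_nonneg _) (hle.trans ?_)
        (by positivity)
      gcongr
      exact le_max_left _ _
    have h2 : C' ≤ ‖x‖ ^ (w - γ) := by
      calc C' = (C' ^ (1 / (w - γ))) ^ (w - γ) := by
            rw [← Real.rpow_mul hC'0.le, one_div_mul_cancel hδ.ne', Real.rpow_one]
        _ ≤ _ := Real.rpow_le_rpow (by positivity) ((le_max_right _ _).trans hbig'.le) hδ.le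
    calc normProd d x ≤ C' * ‖x‖ ^ (-w) := h1
      _ ≤ ‖x‖ ^ (w - γ) * ‖x‖ ^ (-w) := by gcongr
      _ = ‖x‖ ^ (-γ) := by rw [← Real.rpow_add hn]; ring_nf

/-- Every basis of `ℝ^d` can be rescaled so that it spans a lattice of covolume `1`. -/
lemma exists_smul_isUnimodularLattice {d : ℕ} (hd : d ≠ 0)
    (b : Basis (Fin d) ℝ (EuclideanSpace ℝ (Fin d))) :
    ∃ r : ℝ, 0 < r ∧ ∃ b' : Basis (Fin d) ℝ (EuclideanSpace ℝ (Fin d)),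
      (∀ i, b' i = r • b i) ∧ IsUnimodularLattice (Submodule.span ℤ (Set.range b')) := by
  have hd' : (0 : ℝ) < d := by positivity
  set V : ℝ := volume.real (ZSpan.fundamentalDomain b) with hV
  have hV0 : 0 < V := by
    rw [hV, ← ZLattice.covolume_eq_measure_fundamentalDomain _ _
      (ZSpan.isAddFundamentalDomain b volume)]
    exact ZLattice.covolume_pos _ _
  set r : ℝ := V ^ (-(1 / (d : ℝ))) with hr
  have hr0 : 0 < r := by positivity
  let b' := b.unitsSMul (fun _ => Units.mk0 r hr0.ne')
  have hb' : ∀ i, b' i = r • b i := fun i => by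
    simp [b', Basis.unitsSMul_apply, Units.smul_def]
  refine ⟨r, hr0, b', hb', inferInstance, inferInstance, ?_⟩
  rw [ZLattice.covolume_eq_measure_fundamentalDomain _ _
      (ZSpan.isAddFundamentalDomain b' volume), ZSpan.measureReal_fundamentalDomain b' volume b,
      ← hV]
  have : b.det b' = r ^ d := by
    have : (b' : Fin d → _) = fun i => r • b i := funext hb'
    rw [this, AlternatingMap.map_smul_univ]
    simp [b.det_self]
  rw [this, abs_of_pos (by positivity), hr, ← Real.rpow_natCast, ← Real.rpow_mul hV0.le]
  rw [show -(1 / (d : ℝ)) * d = -1 by field_simp, Real.rpow_neg_one, inv_mul_cancel₀ hV0.ne']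

lemma mem_span_range_int_iff {d : ℕ} (b : Fin d → EuclideanSpace ℝ (Fin d))
    (x : EuclideanSpace ℝ (Fin d)) :
    x ∈ Submodule.span ℤ (Set.range b) ↔ ∃ z : Fin d → ℤ, ∑ j, (z j : ℝ) • b j = x := by
  rw [Submodule.mem_span_range_iff_exists_fun]
  simp only [Int.cast_smul_eq_zsmul]

/-- A lattice with infinitely many points on a coordinate axis has `Π = 0` there, so every `γ` is
admissible. -/
lemma top_mem_spectrum {d : ℕ} (hd : 2 ≤ d) : (⊤ : EReal) ∈ spectrum d := by
  obtain ⟨r, hr, b, hb, hΛ⟩ := exists_smul_isUnimodularLattice (d := d) (by omega)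
    (EuclideanSpace.basisFun (Fin d) ℝ).toBasis
  refine ⟨_, hΛ, ?_⟩
  unfold exponent
  refine (EReal.eq_top_iff_forall_lt _).2 fun y => ?_
  refine lt_of_lt_of_le (EReal.coe_lt_coe_iff.2 (lt_add_one y)) (le_sSup ⟨y + 1, ?_, rfl⟩)
  let i₀ : Fin d := ⟨0, by omega⟩
  let i₁ : Fin d := ⟨1, by omega⟩
  have h01 : i₁ ≠ i₀ := by simp [i₀, i₁]
  refine Set.infinite_of_injective_forall_mem (f := fun n : ℤ => n • b i₀) ?_ ?_
  · intro m n h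
    have h' : (m : ℝ) • b i₀ = (n : ℝ) • b i₀ := by
      simpa only [Int.cast_smul_eq_zsmul] using h
    exact_mod_cast smul_left_injective ℝ (b.ne_zero i₀) h'
  · intro n
    refine ⟨Submodule.smul_mem _ n (Submodule.subset_span ⟨i₀, rfl⟩), ?_⟩
    have : normProd d (n • b i₀) = 0 := by
      refine Finset.prod_eq_zero (Finset.mem_univ i₁) ?_
      have h0 : (n • b i₀) i₁ = 0 := by
        simp [hb, h01]
      rw [h0, abs_zero, Real.zero_rpow]
      have : (0 : ℝ) < d := by positivity
      positivity
    rw [this]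
    positivity

/-- A real number `w ≥ 0` belongs to the spectrum as soon as some basis `b` satisfies
`∏ |x_i| ≫ ‖z‖^(-wd)` for all nonzero `x = ∑ z_j b_j`, and `∏ |x_i| ≪ ‖z‖^(-wd)` infinitely
often. -/
lemma mem_spectrum_of_basis {d : ℕ} (hd : d ≠ 0) (b : Basis (Fin d) ℝ (EuclideanSpace ℝ (Fin d)))
    (w c C : ℝ) (hw : 0 ≤ w) (hc : 0 < c) (hC : 0 ≤ C)
    (hlow : ∀ z : Fin d → ℤ, z ≠ 0 →
      c * ‖z‖ ^ (-(w * d)) ≤ ∏ i, |(∑ j, (z j : ℝ) • b j : EuclideanSpace ℝ (Fin d)) i|)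
    (hup : {z : Fin d → ℤ | z ≠ 0 ∧
      ∏ i, |(∑ j, (z j : ℝ) • b j : EuclideanSpace ℝ (Fin d)) i| ≤
        C * ‖z‖ ^ (-(w * d))}.Infinite) :
    (w : EReal) ∈ spectrum d := by
  obtain ⟨r, hr, b', hb, hΛ⟩ := exists_smul_isUnimodularLattice hd b
  refine ⟨_, hΛ, ?_⟩
  -- `K₁` and `K₂` compare the sup norm of the coordinates `z` with the Euclidean norm of the
  -- lattice point.
  let e := b'.equivFun.toContinuousLinearEquiv
  have he : ∀ y : Fin d → ℝ, e.symm y = ∑ j, y j • b' j := fun y => b'.equivFun_symm_apply y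
  obtain ⟨K₁, hK₁, hK₁'⟩ := e.symm.toContinuousLinearMap.bound
  obtain ⟨K₂, hK₂, hK₂'⟩ := e.toContinuousLinearMap.bound
  have hnorm : ∀ z : Fin d → ℤ, ‖fun j => (z j : ℝ)‖ = ‖z‖ := fun z => rfl
  have hx1 : ∀ z : Fin d → ℤ, ‖∑ j, (z j : ℝ) • b' j‖ ≤ K₁ * ‖z‖ := fun z => by
    have := hK₁' (fun j => (z j : ℝ))
    rw [hnorm] at this
    simpa [he] using this
  have hx2 : ∀ z : Fin d → ℤ, ‖z‖ ≤ K₂ * ‖∑ j, (z j : ℝ) • b' j‖ := fun z => by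
    have := hK₂' (e.symm (fun j => (z j : ℝ)))
    rw [he] at this
    have h2 : e (∑ j, (z j : ℝ) • b' j) = fun j => (z j : ℝ) := by
      rw [← he (fun j => (z j : ℝ)), e.apply_symm_apply]
    rw [← hnorm z, ← h2]
    exact this
  have hprod : ∀ z : Fin d → ℤ, ∏ i, |(∑ j, (z j : ℝ) • b' j : EuclideanSpace ℝ (Fin d)) i| =
      r ^ d * ∏ i, |(∑ j, (z j : ℝ) • b j : EuclideanSpace ℝ (Fin d)) i| := fun z => by
    have : (∑ j, (z j : ℝ) • b' j : EuclideanSpace ℝ (Fin d)) = r • ∑ j, (z j : ℝ) • b j := by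
      rw [Finset.smul_sum]
      exact Finset.sum_congr rfl fun j _ => by rw [hb, smul_comm]
    rw [this]
    simp only [PiLp.smul_apply, smul_eq_mul, abs_mul, Finset.prod_mul_distrib, abs_of_pos hr]
    simp
  have hexp : 0 ≤ w * d := by positivity
  refine exponent_eq_of_bounds hd _ ?_ w (r ^ d * c * K₂ ^ (-(w * d)))
    (r ^ d * C * K₁ ^ (w * d)) (by positivity) ?_ ?_
  · intro R
    refine (ZSpan.setFinite_inter b' (Metric.isBounded_closedBall (x := 0) (r := R))).subset ?_
    rintro x ⟨hx, hR⟩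
    exact ⟨by simpa using hR, hx⟩
  · intro x hx hx0
    obtain ⟨z, rfl⟩ := (mem_span_range_int_iff b' x).1 hx
    have hz : z ≠ 0 := by rintro rfl; simp at hx0
    have hzn : 0 < ‖z‖ := norm_pos_iff.2 hz
    rw [hprod, mul_assoc, mul_assoc]
    gcongr
    refine le_trans ?_ (hlow z hz)
    gcongr
    rw [← Real.mul_rpow hK₂.le (norm_nonneg _)]
    exact Real.rpow_le_rpow_of_nonpos hzn (hx2 z) (by linarith)
  · refine (hup.image (f := fun z : Fin d → ℤ => ∑ j, (z j : ℝ) • b' j) ?_).mono ?_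
    · intro z _ z' _ h
      have h' : e.symm (fun j => (z j : ℝ)) = e.symm (fun j => (z' j : ℝ)) := by
        rw [he, he]; exact h
      have := e.symm.injective h'
      ext j
      exact_mod_cast congrFun this j
    · rintro _ ⟨z, ⟨hz, hz'⟩, rfl⟩
      refine ⟨(mem_span_range_int_iff b' _).2 ⟨z, rfl⟩, ?_⟩
      have hzn : 0 < ‖z‖ := norm_pos_iff.2 hz
      have hxn : 0 < ‖∑ j, (z j : ℝ) • b' j‖ := by
        by_contra! h
        have := hx2 z
        nlinarith
      simp only
      rw [hprod, mul_assoc, mul_assoc]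
      gcongr
      refine hz'.trans ?_
      gcongr
      have h3 : ‖z‖ ^ (-(w * d)) = K₁ ^ (w * d) * (K₁ * ‖z‖) ^ (-(w * d)) := by
        rw [Real.mul_rpow hK₁.le hzn.le, ← mul_assoc, ← Real.rpow_add hK₁]
        simp
      rw [h3]
      gcongr ?_ * ?_
      exact Real.rpow_le_rpow_of_nonpos hxn (hx1 z) (by linarith)

end LatticeExponent

/-! ### A real number with prescribed very good approximations. -/

namespace LatticeExponent

/-- Exponents of the denominators `2 ^ denomExp s k` of very good approximations. -/
noncomputable def denomExp (s : ℝ) : ℕ → ℕ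
  | 0 => 2
  | k + 1 => ⌈(s + 1) * denomExp s k⌉₊

/-- Numerators of the partial sums of `∑ 2 ^ (-denomExp s k)`. -/
noncomputable def numer (s : ℝ) : ℕ → ℕ
  | 0 => 1
  | k + 1 => numer s k * 2 ^ (denomExp s (k + 1) - denomExp s k) + 1

lemma two_mul_denomExp_le {s : ℝ} (hs : 1 ≤ s) (k : ℕ) :
    2 * denomExp s k ≤ denomExp s (k + 1) := by
  have h : (s + 1) * denomExp s k ≤ denomExp s (k + 1) := Nat.le_ceil _
  have : (2 * denomExp s k : ℝ) ≤ denomExp s (k + 1) := by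
    refine le_trans ?_ h
    gcongr
    linarith
  exact_mod_cast this

lemma denomExp_pos {s : ℝ} (hs : 1 ≤ s) : ∀ k, 2 ≤ denomExp s k
  | 0 => le_rfl
  | k + 1 => by
    have := denomExp_pos hs k
    have := two_mul_denomExp_le hs k
    omega

/-- The last term of the partial sum adds `1` to an even number, so numerators are odd. -/
lemma coprime_numer {s : ℝ} (hs : 1 ≤ s) (k : ℕ) :
    Nat.Coprime (2 ^ denomExp s k) (numer s k) := by
  refine Nat.Coprime.pow_left _ (Nat.coprime_two_left.2 ?_)
  cases k with
  | zero => exact odd_one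
  | succ k =>
    have h1 := denomExp_pos hs k
    have h2 := two_mul_denomExp_le hs k
    exact Even.add_one ((Nat.even_pow.2 ⟨even_two, by omega⟩).mul_left _)

/-- Rounding the exponent up costs at most a factor `2`. -/
lemma pow_denomExp_bounds {s : ℝ} (hs : 1 ≤ s) (k : ℕ) :
    ((2 ^ denomExp s k : ℕ) : ℝ) ^ (s + 1) ≤ (2 ^ denomExp s (k + 1) : ℕ) ∧
    ((2 ^ denomExp s (k + 1) : ℕ) : ℝ) ≤ 2 * ((2 ^ denomExp s k : ℕ) : ℝ) ^ (s + 1) := by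
  have h1 : (s + 1) * denomExp s k ≤ denomExp s (k + 1) := Nat.le_ceil _
  have h2 : (denomExp s (k + 1) : ℝ) < (s + 1) * denomExp s k + 1 :=
    Nat.ceil_lt_add_one (by positivity)
  have e : ((2 ^ denomExp s k : ℕ) : ℝ) ^ (s + 1) = 2 ^ ((s + 1) * denomExp s k) := by
    push_cast
    rw [← Real.rpow_natCast, ← Real.rpow_mul (by norm_num), mul_comm]
  have e' : ((2 ^ denomExp s (k + 1) : ℕ) : ℝ) = 2 ^ (denomExp s (k + 1) : ℝ) := by
    push_cast
    rw [Real.rpow_natCast]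
  rw [e, e']
  refine ⟨Real.rpow_le_rpow_of_exponent_le (by norm_num) h1, ?_⟩
  calc (2 : ℝ) ^ (denomExp s (k + 1) : ℝ) ≤ 2 ^ ((s + 1) * denomExp s k + 1) :=
        Real.rpow_le_rpow_of_exponent_le (by norm_num) h2.le
    _ = _ := by rw [Real.rpow_add (by norm_num), Real.rpow_one, mul_comm]

/-- For `s ≥ 1` there is a number `α` with infinitely many approximations
`|p_k - α q_k| ≍ q_k ^ (-s)` such that `|x - α y| ≫ max(|x|, |y|) ^ (-2)` for every `(x, y) ≠ 0`
which is not a multiple of some `(p_k, q_k)`. -/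
lemma exists_real_with_approximations {s : ℝ} (hs : 1 ≤ s) :
    ∃ (α : ℝ) (p q : ℕ → ℕ), 0 ≤ α ∧ α ≤ 1 / 2 ∧ StrictMono q ∧ (∀ k, 0 < q k) ∧
      (∀ k, p k ≤ q k) ∧
      (∀ k, 1 / 2 * (q k : ℝ) ^ (-s) ≤ |p k - α * q k| ∧ |p k - α * q k| ≤ 2 * (q k : ℝ) ^ (-s)) ∧
      ∀ x y : ℤ, (x ≠ 0 ∨ y ≠ 0) → (∃ (k : ℕ) (m : ℤ), x = m * p k ∧ y = m * q k) ∨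
        ∀ N : ℝ, |(x : ℝ)| ≤ N → |(y : ℝ)| ≤ N → 1 ≤ 32 * N ^ 2 * |x - α * y| := by
  set p := numer s with hp
  set q : ℕ → ℕ := fun k => 2 ^ denomExp s k with hq
  have hq0 : ∀ k, 0 < q k := fun k => by positivity
  have hq0' : ∀ k, (0 : ℝ) < q k := fun k => by exact_mod_cast hq0 k
  have hqsq : ∀ k, q k ^ 2 ≤ q (k + 1) := fun k => by
    simp only [hq]
    rw [← pow_mul, mul_comm]
    exact Nat.pow_le_pow_right (by norm_num) (two_mul_denomExp_le hs k)
  have hq4 : ∀ k, 4 ≤ q k := fun k => by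
    calc 4 = 2 ^ 2 := by norm_num
      _ ≤ q k := Nat.pow_le_pow_right (by norm_num) (denomExp_pos hs k)
  have hmono : StrictMono q := strictMono_nat_of_lt_succ fun k => by
    nlinarith [hqsq k, hq4 k]
  set u : ℕ → ℝ := fun k => p k / q k with hu
  have hstep : ∀ k, u (k + 1) = u k + 1 / q (k + 1) := fun k => by
    have h1 : q (k + 1) = q k * 2 ^ (denomExp s (k + 1) - denomExp s k) := by
      simp only [hq]
      rw [← pow_add]
      congr 1
      have := two_mul_denomExp_le hs k
      omega
    have h2 : p (k + 1) = p k * 2 ^ (denomExp s (k + 1) - denomExp s k) + 1 := rfl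
    simp only [hu]
    rw [h2, h1]
    have := hq0' k
    push_cast
    field_simp
  have hdouble : ∀ k, (2 : ℝ) * q k ≤ q (k + 1) := fun k => by
    have : 2 * q k ≤ q (k + 1) := by nlinarith [hqsq k, hq4 k]
    exact_mod_cast this
  have humono : Monotone u := monotone_nat_of_le_succ fun k => by
    rw [hstep]
    have := hq0' (k + 1)
    simp
  -- The intervals `[u k, u k + 2 / q (k + 1)]` are nested and enclose `α`.
  have hvanti : Antitone fun k => u k + 2 / q (k + 1) := antitone_nat_of_succ_le fun k => by
    rw [hstep]
    have : (2 : ℝ) / q (k + 1 + 1) ≤ 1 / q (k + 1) := by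
      rw [div_le_div_iff₀ (hq0' _) (hq0' _)]
      linarith [hdouble (k + 1)]
    have h3 : (2 : ℝ) / q (k + 1) = 1 / q (k + 1) + 1 / q (k + 1) := by ring
    linarith
  have huv : ∀ m n, u m ≤ u n + 2 / q (n + 1) := humono.forall_le_of_antitone hvanti fun k => by
    have := hq0' (k + 1)
    simp only [le_add_iff_nonneg_right]
    positivity
  set α := ⨆ k, u k with hα
  have hbdd : BddAbove (Set.range u) := ⟨u 0 + 2 / q (0 + 1), by
    rintro _ ⟨k, rfl⟩; exact huv k 0⟩
  have hle : ∀ k, u k ≤ α := fun k => le_ciSup hbdd k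
  have hup : ∀ k, α ≤ u k + 2 / q (k + 1) := fun k => ciSup_le fun m => huv m k
  have hu0 : u 0 = 1 / 4 := by
    simp only [hu, hp, hq, numer, denomExp]; norm_num
  have hα0 : 0 ≤ α := le_trans (by rw [hu0]; norm_num) (hle 0)
  have hα1 : α ≤ 1 / 2 := by
    refine (hup 0).trans ?_
    have h16 : (16 : ℝ) ≤ q (0 + 1) := by
      have : 16 ≤ q (0 + 1) := by nlinarith [hqsq 0, hq4 0]
      exact_mod_cast this
    have : (2 : ℝ) / q (0 + 1) ≤ 2 / 16 := by gcongr
    rw [hu0]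
    linarith
  have hpq : ∀ k, (p k : ℝ) = u k * q k := fun k => by
    have := hq0' k
    simp only [hu]
    field_simp
  refine ⟨α, p, q, hα0, hα1, hmono, hq0, fun k => ?_, fun k => ?_, fun x y hxy => ?_⟩
  · have h1 : (p k : ℝ) ≤ q k := by
      rw [hpq]
      nlinarith [hle k, hq0' k]
    exact_mod_cast h1
  · have hk := hq0' k
    have hk1 := hq0' (k + 1)
    have habs : |(p k : ℝ) - α * q k| = (α - u k) * q k := by
      rw [hpq, ← sub_mul, abs_mul, abs_of_pos hk, abs_sub_comm, abs_of_nonneg (by linarith [hle k])]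
    have hpw : (q k : ℝ) ^ (-s) = q k / (q k : ℝ) ^ (s + 1) := by
      rw [Real.rpow_add hk, Real.rpow_neg hk.le, Real.rpow_one]
      field_simp
    obtain ⟨b1, b2⟩ := pow_denomExp_bounds hs k
    change (q k : ℝ) ^ (s + 1) ≤ q (k + 1) at b1
    change (q (k + 1) : ℝ) ≤ 2 * (q k : ℝ) ^ (s + 1) at b2
    have hQ : 0 < (q k : ℝ) ^ (s + 1) := by positivity
    rw [habs, hpw]
    constructor
    · have h1 : 1 / (q (k + 1) : ℝ) ≤ α - u k := by linarith [hle (k + 1), hstep k]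
      calc 1 / 2 * ((q k : ℝ) / (q k : ℝ) ^ (s + 1)) = 1 / (2 * (q k : ℝ) ^ (s + 1)) * q k := by
            field_simp
        _ ≤ 1 / (q (k + 1) : ℝ) * q k := by gcongr
        _ ≤ _ := by gcongr
    · have h1 : α - u k ≤ 2 / (q (k + 1) : ℝ) := by linarith [hup k]
      calc (α - u k) * q k ≤ 2 / (q (k + 1) : ℝ) * q k := by gcongr
        _ ≤ 2 / (q k : ℝ) ^ (s + 1) * q k := by gcongr
        _ = _ := by ring
  · by_cases hy : y = 0
    · right
      intro N hN _
      have hx : x ≠ 0 := by tauto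
      have h1 : (1 : ℝ) ≤ |(x : ℝ)| := by exact_mod_cast Int.one_le_abs hx
      subst hy
      simp only [Int.cast_zero, mul_zero, sub_zero]
      nlinarith
    have hY : (1 : ℝ) ≤ |(y : ℝ)| := by exact_mod_cast Int.one_le_abs hy
    set Y := y.natAbs with hYdef
    have hYr : (Y : ℝ) = |(y : ℝ)| := by rw [hYdef, Nat.cast_natAbs, Int.cast_abs]
    -- The least such `k` makes `y (α - u k) q k` at most `1/2` in absolute value, while minimality
    -- and `q j ^ 2 ≤ q (j + 1)` keep `q k ≤ 16 Y ^ 2`.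
    have hex : ∃ k, 4 * Y * q k ≤ q (k + 1) := by
      refine ⟨4 * Y, le_trans ?_ (hqsq _)⟩
      rw [pow_two]
      gcongr
      exact hmono.id_le _
    classical
    set k := Nat.find hex with hkdef
    have hk : 4 * Y * q k ≤ q (k + 1) := Nat.find_spec hex
    have hk16 : q k ≤ 16 * Y ^ 2 := by
      have hY1 : 1 ≤ Y := by rw [← hYr] at hY; exact_mod_cast hY
      rcases Nat.eq_zero_or_pos k with h0 | h0
      · rw [h0]
        simp only [hq, denomExp]
        nlinarith
      · obtain ⟨j, hj⟩ := Nat.exists_eq_succ_of_ne_zero h0.ne'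
        have hnot : ¬ 4 * Y * q j ≤ q (j + 1) := Nat.find_min hex (by omega)
        have h5 := hqsq j
        push Not at hnot
        have h6 : q j < 4 * Y := by nlinarith [hq0 j]
        rw [hj, Nat.succ_eq_add_one]
        nlinarith
    -- Equality makes `(x, y)` a multiple of `(p k, q k)` by coprimality; otherwise the integer `x
    -- q_k - y p_k` is at least `1` in absolute value, which leaves `|x - α y| q_k ≥ 1/2`.
    by_cases hspec : x * q k = y * p k
    · left
      have hcop : IsCoprime ((q k : ℕ) : ℤ) (p k : ℕ) := Nat.isCoprime_iff_coprime.2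
        (coprime_numer hs k)
      have hdvd : ((q k : ℕ) : ℤ) ∣ y := hcop.dvd_of_dvd_mul_right ⟨x, by rw [← hspec]; ring⟩
      obtain ⟨m, hm⟩ := hdvd
      refine ⟨k, m, ?_, by rw [hm]; ring⟩
      have hqz : ((q k : ℕ) : ℤ) ≠ 0 := by exact_mod_cast (hq0 k).ne'
      refine mul_right_cancel₀ hqz ?_
      rw [hspec, hm]; ring
    · right
      intro N _ hN
      have hk0 := hq0' k
      have h1 : (1 : ℝ) ≤ |(x : ℝ) * q k - y * p k| := by
        have : 1 ≤ |x * q k - y * p k| := Int.one_le_abs (sub_ne_zero.2 hspec)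
        exact_mod_cast this
      have h2 : (x : ℝ) * q k - y * p k = (x - α * y) * q k + y * (α - u k) * q k := by
        rw [hpq]; ring
      have h3 : |(x : ℝ) * q k - y * p k| ≤ |x - α * y| * q k + |(y : ℝ)| * (α - u k) * q k := by
        rw [h2]
        refine (abs_add_le _ _).trans ?_
        rw [abs_mul, abs_mul, abs_mul, abs_of_pos hk0, abs_of_nonneg (by linarith [hle k] : 0 ≤ α - u k)]
      have h4 : |(y : ℝ)| * (α - u k) * q k ≤ 1 / 2 := by
        have hk' : 4 * |(y : ℝ)| * q k ≤ q (k + 1) := by rw [← hYr]; exact_mod_cast hk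
        have := hq0' (k + 1)
        calc |(y : ℝ)| * (α - u k) * q k ≤ |(y : ℝ)| * (2 / q (k + 1)) * q k := by
              gcongr; linarith [hup k]
          _ = 2 * (|(y : ℝ)| * q k) / q (k + 1) := by ring
          _ ≤ 1 / 2 := by rw [div_le_iff₀ this]; linarith
      have h5 : (q k : ℝ) ≤ 16 * N ^ 2 := by
        have : (q k : ℝ) ≤ 16 * |(y : ℝ)| ^ 2 := by rw [← hYr]; exact_mod_cast hk16
        refine this.trans ?_
        gcongr
      have h6 : |x - α * y| * q k ≤ |x - α * y| * (16 * N ^ 2) := by gcongr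
      nlinarith

end LatticeExponent

/-! ### Averaging over random coefficients. -/

namespace LatticeExponent

open MeasureTheory unitInterval
open scoped ENNReal

lemma lintegral_enorm_rpow_neg_half_lt_top :
    ∫⁻ u in Set.Icc (-1 : ℝ) 1, ‖u‖ₑ ^ (-(1 / 2) : ℝ) < ∞ := by
  have h01 : ∫⁻ u in Set.Ioc (0 : ℝ) 1, ‖u‖ₑ ^ (-(1 / 2) : ℝ) < ∞ := by
    have h := (intervalIntegral.intervalIntegrable_rpow' (a := 0) (b := 1)
      (r := -(1 / 2)) (by norm_num)).1.2
    refine lt_of_eq_of_lt (setLIntegral_congr_fun measurableSet_Ioc fun u hu => ?_) h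
    simp only
    rw [Real.enorm_of_nonneg hu.1.le, ENNReal.ofReal_rpow_of_pos hu.1,
      Real.enorm_of_nonneg (by have := hu.1; positivity)]
  have hneg : ∫⁻ u in Set.Ico (-1 : ℝ) 0, ‖u‖ₑ ^ (-(1 / 2) : ℝ) =
      ∫⁻ u in Set.Ioc (0 : ℝ) 1, ‖u‖ₑ ^ (-(1 / 2) : ℝ) := by
    rw [← (Measure.measurePreserving_neg (volume : Measure ℝ)).setLIntegral_comp_preimage
      measurableSet_Ico (by fun_prop)]
    simp
  have hset : Set.Icc (-1 : ℝ) 1 = (Set.Ico (-1) 0 ∪ Set.Ioc 0 1) ∪ {0} := by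
    ext x
    simp only [Set.mem_Icc, Set.mem_union, Set.mem_Ico, Set.mem_Ioc, Set.mem_singleton_iff]
    constructor
    · rintro ⟨h1, h2⟩
      rcases lt_trichotomy x 0 with h | h | h <;> tauto
    · rintro ((⟨h1, h2⟩ | ⟨h1, h2⟩) | h) <;> constructor <;> linarith
  rw [hset]
  refine lt_of_le_of_lt (lintegral_union_le _ _ _) (ENNReal.add_lt_top.2 ⟨?_, by simp⟩)
  refine lt_of_le_of_lt (lintegral_union_le _ _ _) (ENNReal.add_lt_top.2 ⟨?_, h01⟩)
  rw [hneg]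
  exact h01

/-- Factoring out `a` leaves a translate of `|u|^(-1/2)`, which is at most `1` plus an integrable
function; translation invariance makes `K` independent of `a` and `b`. -/
lemma exists_lintegral_affine_le :
    ∃ K : ℝ≥0∞, K ≠ ∞ ∧ ∀ a b : ℝ, a ≠ 0 →
      ∫⁻ τ : I, ‖b + τ * a‖ₑ ^ (-(1 / 2) : ℝ) ≤ K * ‖a‖ₑ ^ (-(1 / 2) : ℝ) := by
  refine ⟨1 + ∫⁻ u in Set.Icc (-1 : ℝ) 1, ‖u‖ₑ ^ (-(1 / 2) : ℝ),
    ENNReal.add_ne_top.2 ⟨ENNReal.one_ne_top, lintegral_enorm_rpow_neg_half_lt_top.ne⟩,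
    fun a b ha => ?_⟩
  set h : ℝ → ℝ≥0∞ := (Set.Icc (-1 : ℝ) 1).indicator fun u => ‖u‖ₑ ^ (-(1 / 2) : ℝ) with hh
  have hmeas : Measurable h := Measurable.indicator (by fun_prop) measurableSet_Icc
  have hle : ∀ u : ℝ, ‖u‖ₑ ^ (-(1 / 2) : ℝ) ≤ 1 + h u := fun u => by
    by_cases hu : u ∈ Set.Icc (-1 : ℝ) 1
    · simp [hh, hu]
    · refine le_add_right ?_
      have h1 : (1 : ℝ) ≤ |u| := by
        by_contra! h1
        exact hu ⟨(abs_lt.1 h1).1.le, (abs_lt.1 h1).2.le⟩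
      have h2 : (1 : ℝ≥0∞) ≤ ‖u‖ₑ := by
        rw [Real.enorm_eq_ofReal_abs]
        simpa using ENNReal.ofReal_le_ofReal h1
      rw [ENNReal.rpow_neg, ENNReal.inv_le_one]
      exact ENNReal.one_le_rpow h2 (by norm_num)
  have hpt : ∀ τ : I, ‖b + τ * a‖ₑ ^ (-(1 / 2) : ℝ) ≤
      (1 + h (b / a + τ)) * ‖a‖ₑ ^ (-(1 / 2) : ℝ) := fun τ => by
    have : b + τ * a = (b / a + τ) * a := by field_simp
    rw [this, enorm_mul, ENNReal.mul_rpow_of_ne_top (by simp) (by simp)]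
    gcongr
    exact hle _
  calc ∫⁻ τ : I, ‖b + τ * a‖ₑ ^ (-(1 / 2) : ℝ)
      ≤ ∫⁻ τ : I, (1 + h (b / a + τ)) * ‖a‖ₑ ^ (-(1 / 2) : ℝ) := lintegral_mono hpt
    _ = (1 + ∫⁻ τ : I, h (b / a + τ)) * ‖a‖ₑ ^ (-(1 / 2) : ℝ) := by
        rw [lintegral_mul_const _ (by fun_prop), lintegral_add_left measurable_const]
        simp
    _ ≤ _ := by
        gcongr
        calc ∫⁻ τ : I, h (b / a + τ) = ∫⁻ τ in I, h (b / a + τ) :=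
              unitInterval.measurePreserving_coe.lintegral_comp
                (f := fun x => h (b / a + x)) (by fun_prop)
          _ ≤ ∫⁻ τ, h (b / a + τ) := setLIntegral_le_lintegral _ _
          _ = ∫⁻ τ, h τ := lintegral_add_left_eq_self h _
          _ = _ := by rw [hh, lintegral_indicator measurableSet_Icc]

/-- Fubini: all coefficients but `t j` are frozen and absorbed into the shift. -/
lemma exists_lintegral_linear_le :
    ∃ K : ℝ≥0∞, K ≠ ∞ ∧ ∀ (d : ℕ) (y : Fin d → ℝ) (j : Fin d) (b : ℝ), y j ≠ 0 →
      ∫⁻ t : Fin d → I, ‖b + ∑ i, t i * y i‖ₑ ^ (-(1 / 2) : ℝ) ≤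
        K * ‖y j‖ₑ ^ (-(1 / 2) : ℝ) := by
  obtain ⟨K, hK, hK'⟩ := exists_lintegral_affine_le
  refine ⟨K, hK, fun d y j b hj => ?_⟩
  obtain _ | n := d
  · exact j.elim0
  have hmp := (volume_preserving_piFinSuccAbove (fun _ : Fin (n + 1) => I) j).symm
  have he : ∀ (τ : I) (x : Fin n → I),
      (MeasurableEquiv.piFinSuccAbove (fun _ : Fin (n + 1) => I) j).symm (τ, x) =
        j.insertNth τ x := fun _ _ => rfl
  rw [← hmp.lintegral_comp (f := fun t : Fin (n + 1) → I =>
    ‖b + ∑ i, t i * y i‖ₑ ^ (-(1 / 2) : ℝ)) (by fun_prop)]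
  rw [Measure.volume_eq_prod, lintegral_prod_symm' _ (by fun_prop)]
  calc _ ≤ ∫⁻ _ : Fin n → I, K * ‖y j‖ₑ ^ (-(1 / 2) : ℝ) := by
        refine lintegral_mono fun x => ?_
        refine le_trans (le_of_eq ?_) (hK' (y j) (b + ∑ i, x i * y (j.succAbove i)) hj)
        refine lintegral_congr fun τ => ?_
        congr 2
        rw [Fin.sum_univ_succAbove _ j]
        simp only [he, Fin.insertNth_apply_same, Fin.insertNth_apply_succAbove]
        ring
    _ = _ := by simp

/-- First moment method: by Tonelli the sum has finite mean, hence is finite almost everywhere. -/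
lemma exists_tsum_ne_top {Ω ι : Type*} [MeasurableSpace Ω] [Countable ι] (μ : Measure Ω)
    [IsProbabilityMeasure μ] (F : Ω → ι → ℝ≥0∞) (hF : ∀ z, Measurable fun ω => F ω z)
    (c g : ι → ℝ≥0∞) (hg : ∀ z, ∫⁻ ω, F ω z ∂μ ≤ g z) (hsum : ∑' z, c z * g z ≠ ∞) :
    ∃ ω, ∑' z, c z * F ω z ≠ ∞ := by
  have hmeas : Measurable fun ω => ∑' z, c z * F ω z :=
    Measurable.tsum fun z => (hF z).const_mul _
  have hint : ∫⁻ ω, ∑' z, c z * F ω z ∂μ ≠ ∞ := by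
    rw [lintegral_tsum fun z => ((hF z).const_mul _).aemeasurable]
    refine ne_top_of_le_ne_top hsum (ENNReal.tsum_le_tsum fun z => ?_)
    rw [lintegral_const_mul _ (hF z)]
    gcongr
    exact hg z
  obtain ⟨ω, hω⟩ := (ae_lt_top hmeas hint).exists
  exact ⟨ω, hω.ne⟩

lemma exists_apply_enorm_eq {d : ℕ} {z : Fin d → ℤ} (hz : z ≠ 0) :
    ∃ j, z j ≠ 0 ∧ ‖(z j : ℝ)‖ₑ = ‖z‖ₑ := by
  obtain ⟨j₀, -⟩ := Function.ne_iff.1 hz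
  obtain ⟨j, -, hj⟩ := Finset.exists_mem_eq_sup Finset.univ ⟨j₀, Finset.mem_univ _⟩ fun j => ‖z j‖₊
  have h1 : ‖z‖₊ = ‖z j‖₊ := by
    rw [Pi.nnnorm_def, hj]
  refine ⟨j, fun h => ?_, ?_⟩
  · rw [h, nnnorm_zero, nnnorm_eq_zero] at h1
    exact hz h1
  · rw [enorm_eq_nnnorm, enorm_eq_nnnorm, h1]
    rfl

/-- Rows of coefficients in `[0, 1]` can be chosen so that the forms they define, shifted by
prescribed amounts, are on average not too small. -/
lemma exists_rows_tsum_ne_top {d : ℕ} (T : Set (Fin d → ℤ)) (hT : ∀ z ∈ T, z ≠ 0)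
    (v : Fin d → (Fin d → ℤ) → ℝ) (s : Finset (Fin d)) (c : T → ℝ≥0∞)
    (hc : ∑' z : T, c z * (‖z.1‖ₑ ^ (-(1 / 2) : ℝ)) ^ s.card ≠ ∞) :
    ∃ t : Fin d → Fin d → I,
      ∑' z : T, c z * ∏ i ∈ s, ‖v i z + ∑ j, t i j * (z.1 j : ℝ)‖ₑ ^ (-(1 / 2) : ℝ) ≠ ∞ := by
  classical
  obtain ⟨K, hK, hK'⟩ := exists_lintegral_linear_le
  induction s using Finset.induction_on generalizing c with
  | empty => exact ⟨fun _ _ => 0, by simpa using hc⟩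
  | insert a s ha ih =>
    -- The expected contribution of row `a` goes into the weight while the other rows are chosen;
    -- row `a` is then drawn against them.
    obtain ⟨t, ht⟩ := ih (fun z => c z * ‖z.1‖ₑ ^ (-(1 / 2) : ℝ)) (by
      rw [Finset.card_insert_of_notMem ha] at hc
      simpa only [pow_succ', mul_assoc] using hc)
    obtain ⟨x, hx⟩ := exists_tsum_ne_top (volume : Measure (Fin d → I))
      (fun x (z : T) => ‖v a z + ∑ j, x j * (z.1 j : ℝ)‖ₑ ^ (-(1 / 2) : ℝ))
      (fun z => by fun_prop)
      (fun z => c z * ∏ i ∈ s, ‖v i z + ∑ j, t i j * (z.1 j : ℝ)‖ₑ ^ (-(1 / 2) : ℝ))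
      (fun z => K * ‖z.1‖ₑ ^ (-(1 / 2) : ℝ))
      (fun z => by
        obtain ⟨j, hj, hj'⟩ := exists_apply_enorm_eq (hT z z.2)
        rw [← hj']
        exact hK' d _ j _ (by exact_mod_cast hj))
      (by
        refine ne_of_eq_of_ne (tsum_congr fun z => ?_)
          (ENNReal.tsum_mul_left (a := K) ▸ ENNReal.mul_ne_top hK ht)
        ring)
    refine ⟨Function.update t a x, ne_of_eq_of_ne (tsum_congr fun z => ?_) hx⟩
    rw [Finset.prod_insert ha, Function.update_self, mul_comm (‖_‖ₑ ^ _), ← mul_assoc]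
    congr 2
    refine Finset.prod_congr rfl fun i hi => ?_
    rw [Function.update_of_ne (by rintro rfl; exact ha hi)]

lemma enorm_rpow_neg_half_le {x N : ℝ} (hN : 0 < N) (h : 1 ≤ 36 * N ^ 2 * |x|) :
    ‖x‖ₑ ^ (-(1 / 2) : ℝ) ≤ ENNReal.ofReal (6 * N) := by
  have hx : 0 < |x| := by
    by_contra! h0
    have : |x| = 0 := le_antisymm h0 (abs_nonneg x)
    rw [this] at h
    linarith
  rw [Real.enorm_eq_ofReal_abs, ENNReal.ofReal_rpow_of_pos hx]
  refine ENNReal.ofReal_le_ofReal ?_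
  have h1 : (6 * N) ^ (-2 : ℝ) ≤ |x| := by
    rw [Real.rpow_neg (by positivity), inv_le_iff_one_le_mul₀ (by positivity)]
    norm_cast
    linarith
  calc |x| ^ (-(1 / 2) : ℝ) ≤ ((6 * N) ^ (-2 : ℝ)) ^ (-(1 / 2) : ℝ) :=
        Real.rpow_le_rpow_of_nonpos (by positivity) h1 (by norm_num)
    _ = 6 * N := by rw [← Real.rpow_mul (by positivity)]; norm_num

/-- The row carrying `α` cannot be perturbed at `i₀` and `i₁`. A nonzero coordinate elsewhere still
gives a bounded mean; without one, `hv` bounds the term by `6 ‖z‖`. Either way the cost is a factor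
`‖z‖`. -/
lemma exists_row_tsum_ne_top {d : ℕ} (T : Set (Fin d → ℤ)) (hT : ∀ z ∈ T, z ≠ 0) (i₀ i₁ : Fin d)
    (v : (Fin d → ℤ) → ℝ)
    (hv : ∀ z ∈ T, (∀ j, j ≠ i₀ → j ≠ i₁ → z j = 0) → 1 ≤ 36 * ‖z‖ ^ 2 * |v z|)
    (c : T → ℝ≥0∞) (hc : ∑' z : T, c z * ‖z.1‖ₑ ≠ ∞) :
    ∃ t : Fin d → I, ∑' z : T, c z *
      ‖v z + ∑ j, t j * (if j = i₀ ∨ j = i₁ then 0 else (z.1 j : ℝ))‖ₑ ^ (-(1 / 2) : ℝ) ≠ ∞ := by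
  obtain ⟨K, hK, hK'⟩ := exists_lintegral_linear_le
  refine exists_tsum_ne_top (volume : Measure (Fin d → I)) _ (fun z => by fun_prop) c
    (fun z => (K + 6) * ‖z.1‖ₑ) (fun z => ?_) ?_
  · have hone : ∀ m : ℤ, m ≠ 0 → (1 : ℝ≥0∞) ≤ ‖(m : ℝ)‖ₑ := fun m hm => by
      rw [Real.enorm_eq_ofReal_abs, ENNReal.one_le_ofReal]
      exact_mod_cast Int.one_le_abs hm
    have hz0 := hT z z.2
    obtain ⟨k, hk, hk'⟩ := exists_apply_enorm_eq hz0
    have hz1 : 1 ≤ ‖z.1‖ₑ := hk' ▸ hone _ hk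
    by_cases h : ∀ j, j ≠ i₀ → j ≠ i₁ → z.1 j = 0
    · have hsum : ∀ t : Fin d → I,
          ∑ j, (t j : ℝ) * (if j = i₀ ∨ j = i₁ then 0 else (z.1 j : ℝ)) = 0 := fun t => by
        refine Finset.sum_eq_zero fun j _ => ?_
        split_ifs with hj
        · simp
        · push Not at hj
          simp [h j hj.1 hj.2]
      simp only [hsum, add_zero, lintegral_const, measure_univ, mul_one]
      refine (enorm_rpow_neg_half_le (norm_pos_iff.2 hz0) (hv z z.2 h)).trans ?_
      rw [ENNReal.ofReal_mul (by norm_num), ofReal_norm, ENNReal.ofReal_ofNat]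
      gcongr
      exact le_add_self
    · push Not at h
      obtain ⟨j, h0, h1, hj⟩ := h
      refine (hK' d (fun j => if j = i₀ ∨ j = i₁ then 0 else (z.1 j : ℝ)) j _
        (by simpa [h0, h1] using hj)).trans ?_
      simp only [h0, h1, or_self, if_false]
      gcongr
      · exact le_self_add
      · refine le_trans ?_ hz1
        rw [ENNReal.rpow_neg, ENNReal.inv_le_one]
        exact ENNReal.one_le_rpow (hone _ hj) (by norm_num)
  · refine ne_of_eq_of_ne (tsum_congr fun z => ?_)
      (ENNReal.tsum_mul_left (a := K + 6) ▸ ENNReal.mul_ne_top (by simp [hK]) hc)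
    ring

/-! ### Convergence over integer points and the resulting lower bound. -/

lemma summable_int_norm_rpow {d : ℕ} {r : ℝ} (hr : r < -d) :
    Summable fun z : Fin d → ℤ => ‖z‖ ^ r := by
  let b := Pi.basisFun ℝ (Fin d)
  let L := Submodule.span ℤ (Set.range b)
  have hL : Module.finrank ℤ L = d := by
    rw [ZLattice.rank ℝ L]
    simp
  have hmem : ∀ z : Fin d → ℤ, (fun j => (z j : ℝ)) ∈ L := fun z => by
    refine (Submodule.mem_span_range_iff_exists_fun ℤ).2 ⟨z, ?_⟩
    ext j
    simp [b, Finset.sum_apply, Pi.single_apply]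
  have h : Summable fun z : L => ‖z‖ ^ r := ZLattice.summable_norm_rpow L r (by rw [hL]; exact hr)
  let f : (Fin d → ℤ) → L := fun z => ⟨fun j => (z j : ℝ), hmem z⟩
  have hf : Function.Injective f := fun z z' h => by
    ext j
    have h' : (z j : ℝ) = z' j := congrFun (congrArg Subtype.val h) j
    exact_mod_cast h'
  have hnorm : ∀ z, ‖f z‖ = ‖z‖ := fun z => rfl
  simpa only [Function.comp_def, hnorm] using h.comp_injective hf

lemma tsum_enorm_rpow_ne_top {d : ℕ} {r : ℝ} (hr : r < -d) (T : Set (Fin d → ℤ))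
    (hT : ∀ z ∈ T, z ≠ 0) : ∑' z : T, ‖z.1‖ₑ ^ r ≠ ∞ := by
  have h := ((summable_int_norm_rpow hr).comp_injective
    (Subtype.val_injective (p := (· ∈ T)))).tsum_ofReal_ne_top
  refine ne_of_eq_of_ne (tsum_congr fun z => ?_) h
  have := norm_pos_iff.2 (hT z z.2)
  rw [Function.comp_apply, ← ENNReal.ofReal_rpow_of_pos this, ofReal_norm]

lemma exists_bound_of_tsum_ne_top {ι : Type*} {f : ι → ℝ≥0∞} (h : ∑' z, f z ≠ ∞) :
    ∃ S : ℝ, 0 < S ∧ ∀ z, f z ≤ ENNReal.ofReal S := by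
  refine ⟨(∑' z, f z).toReal + 1, by positivity, fun z => (ENNReal.le_tsum z).trans ?_⟩
  rw [ENNReal.le_ofReal_iff_toReal_le h (by positivity)]
  linarith

lemma prod_lower_bound_of_rpow_le {d : ℕ} (y : Fin d → ℝ) {N e S : ℝ} (hN : 0 < N) (hS : 0 < S)
    (h : ENNReal.ofReal (N ^ (-(e / 2))) * ∏ i, ‖y i‖ₑ ^ (-(1 / 2) : ℝ) ≤ ENNReal.ofReal S) :
    S ^ (-2 : ℝ) * N ^ (-e) ≤ ∏ i, |y i| := by
  set P := ∏ i, |y i| with hP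
  have hne : ENNReal.ofReal (N ^ (-(e / 2))) ≠ 0 := by
    rw [Ne, ENNReal.ofReal_eq_zero, not_le]
    positivity
  -- In `ℝ≥0∞` a vanishing form contributes `0 ^ (-1/2) = ∞`, so finiteness excludes zeros.
  have hy : ∀ i, 0 < |y i| := fun i => by
    refine abs_pos.2 fun h0 => ?_
    have hnz : ∀ j, ‖y j‖ₑ ^ (-(1 / 2) : ℝ) ≠ 0 := fun j => by
      simp [ENNReal.rpow_eq_zero_iff]
    have htop : ∏ i, ‖y i‖ₑ ^ (-(1 / 2) : ℝ) = ∞ := by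
      refine WithTop.prod_eq_top (Finset.mem_univ i) ?_ ?_
      · simp [h0]
        rfl
      · exact fun j _ => hnz j
    rw [htop, ENNReal.mul_top hne, top_le_iff] at h
    exact ENNReal.ofReal_ne_top h
  have hP0 : 0 < P := Finset.prod_pos fun i _ => hy i
  have h1 : ∏ i, ‖y i‖ₑ ^ (-(1 / 2) : ℝ) = ENNReal.ofReal (P ^ (-(1 / 2) : ℝ)) := by
    rw [hP, ← Real.finsetProd_rpow _ _ fun i _ => (hy i).le,
      ENNReal.ofReal_prod_of_nonneg fun i _ => by positivity]
    refine Finset.prod_congr rfl fun i _ => ?_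
    rw [Real.enorm_eq_ofReal_abs, ENNReal.ofReal_rpow_of_pos (hy i)]
  rw [h1, ← ENNReal.ofReal_mul (by positivity), ENNReal.ofReal_le_ofReal_iff hS.le] at h
  have h2 := Real.rpow_le_rpow_of_nonpos (by positivity) h (by norm_num : (-2 : ℝ) ≤ 0)
  rw [Real.mul_rpow (by positivity) (by positivity), ← Real.rpow_mul hN.le,
    ← Real.rpow_mul hP0.le] at h2
  norm_num at h2
  calc S ^ (-2 : ℝ) * N ^ (-e) ≤ N ^ e * P * N ^ (-e) := by
        gcongr
        rw [Real.rpow_neg hS.le]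
        exact_mod_cast h2
    _ = P * (N ^ e * N ^ (-e)) := by ring
    _ = P := by rw [← Real.rpow_add hN]; simp

/-- The lower bound `∏ |L_i(z)| ≫ ‖z‖ ^ (-wd)` for forms `L_i` with suitable coefficients, at all
integer points where `L_{i₀}` is not extremely small for trivial reasons. -/
lemma exists_rows_lower_bound {d : ℕ} (hd : 3 ≤ d) (w : ℝ) (hw : 9 / 4 ≤ w) (i₀ i₁ : Fin d)
    (v : Fin d → (Fin d → ℤ) → ℝ) :
    ∃ (t : Fin d → Fin d → I) (c : ℝ), 0 < c ∧ ∀ z : Fin d → ℤ, z ≠ 0 →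
      ((∀ j, j ≠ i₀ → j ≠ i₁ → z j = 0) → 1 ≤ 36 * ‖z‖ ^ 2 * |v i₀ z|) →
      c * ‖z‖ ^ (-(w * d)) ≤ ∏ i, |v i z + ∑ j, t i j *
        (if i = i₀ ∧ (j = i₀ ∨ j = i₁) then 0 else (z j : ℝ))| := by
  classical
  set T : Set (Fin d → ℤ) := {z | z ≠ 0 ∧
    ((∀ j, j ≠ i₀ → j ≠ i₁ → z j = 0) → 1 ≤ 36 * ‖z‖ ^ 2 * |v i₀ z|)} with hTdef
  have hT : ∀ z ∈ T, z ≠ 0 := fun z hz => hz.1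
  have hd3 : (3 : ℝ) ≤ d := by exact_mod_cast hd
  have hcard : (Finset.univ.erase i₀).card = d - 1 := by simp
  obtain ⟨x, hx⟩ := exists_row_tsum_ne_top T hT i₀ i₁ (v i₀) (fun z hz => hz.2)
    (fun z => ‖z.1‖ₑ ^ (-(w * d / 2)) * (‖z.1‖ₑ ^ (-(1 / 2) : ℝ)) ^ (d - 1)) (by
      refine ne_of_eq_of_ne (tsum_congr fun z => ?_) (tsum_enorm_rpow_ne_top
        (r := -(w * d / 2) + -(1 / 2) * (d - 1 : ℕ) + 1) ?_ T hT)
      · have h0 : ‖z.1‖ₑ ≠ 0 := by simpa using hT z z.2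
        have ht : ‖z.1‖ₑ ≠ ∞ := by simp
        rw [ENNReal.rpow_add _ _ h0 ht, ENNReal.rpow_add _ _ h0 ht, ENNReal.rpow_one,
          ENNReal.rpow_mul, ENNReal.rpow_natCast]
      -- Convergence amounts to `w d > d + 3`, which `w ≥ 9/4` and `d ≥ 3` ensure.
      · rw [Nat.cast_sub (by omega)]
        push_cast
        nlinarith)
  obtain ⟨t, ht⟩ := exists_rows_tsum_ne_top T hT v (Finset.univ.erase i₀)
    (fun z => ‖z.1‖ₑ ^ (-(w * d / 2)) * ‖v i₀ z + ∑ j, x j *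
      (if j = i₀ ∨ j = i₁ then 0 else (z.1 j : ℝ))‖ₑ ^ (-(1 / 2) : ℝ)) (by
      rw [hcard]
      refine ne_of_eq_of_ne (tsum_congr fun z => ?_) hx
      ring)
  obtain ⟨S, hS, hSt⟩ := exists_bound_of_tsum_ne_top ht
  refine ⟨Function.update t i₀ x, S ^ (-2 : ℝ), by positivity, fun z hz hz' => ?_⟩
  have hzn := norm_pos_iff.2 hz
  refine prod_lower_bound_of_rpow_le _ hzn hS (le_trans (le_of_eq ?_) (hSt ⟨z, hz, hz'⟩))
  rw [← ENNReal.ofReal_rpow_of_pos hzn, ofReal_norm,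
    ← Finset.mul_prod_erase _ _ (Finset.mem_univ i₀), ← mul_assoc]
  congr 1
  · simp
  · refine Finset.prod_congr rfl fun i hi => ?_
    have hi' : i ≠ i₀ := Finset.ne_of_mem_erase hi
    simp [hi']

end LatticeExponent

/-! ### The perturbed matrix and the conclusion. -/

namespace LatticeExponent

open Module unitInterval

lemma exists_basis_of_det_ne_zero {d : ℕ} (M : Matrix (Fin d) (Fin d) ℝ) (hM : M.det ≠ 0) :
    ∃ b : Basis (Fin d) ℝ (EuclideanSpace ℝ (Fin d)), ∀ (z : Fin d → ℤ) (i : Fin d),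
      (∑ j, (z j : ℝ) • b j : EuclideanSpace ℝ (Fin d)) i = ∑ j, M i j * z j := by
  refine ⟨((Pi.basisFun ℝ (Fin d)).map (M.toLinearEquiv'
    (M.invertibleOfIsUnitDet hM.isUnit))).map (WithLp.linearEquiv 2 ℝ (Fin d → ℝ)).symm,
    fun z i => ?_⟩
  have h : ∀ x, M.toLinearEquiv' (M.invertibleOfIsUnitDet hM.isUnit) x = M.mulVec x :=
    fun _ => rfl
  simp [h, mul_comm]

/-- The matrix with first row `A (x_{i₀} - α x_{i₁})` and diagonal entries about `A`, perturbed
by `t`. -/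
noncomputable def perturbedMatrix {d : ℕ} (A α : ℝ) (i₀ i₁ : Fin d) (t : Fin d → Fin d → I) :
    Matrix (Fin d) (Fin d) ℝ := fun i j =>
  (if i = i₀ then (if j = i₀ then A else if j = i₁ then -(A * α) else 0)
    else (if j = i then A else 0) + 1) +
  t i j * (if i = i₀ ∧ (j = i₀ ∨ j = i₁) then 0 else 1)

lemma perturbedMatrix_sum_mul {d : ℕ} (A α : ℝ) {i₀ i₁ : Fin d} (h01 : i₁ ≠ i₀)
    (t : Fin d → Fin d → I) (i : Fin d) (z : Fin d → ℤ) :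
    ∑ j, perturbedMatrix A α i₀ i₁ t i j * z j =
      (if i = i₀ then A * (z i₀ - α * z i₁) else A * z i + ∑ j, (z j : ℝ)) +
      ∑ j, t i j * (if i = i₀ ∧ (j = i₀ ∨ j = i₁) then 0 else (z j : ℝ)) := by
  simp only [perturbedMatrix, add_mul, Finset.sum_add_distrib]
  congr 1
  · split_ifs with hi
    · rw [Fintype.sum_eq_add i₀ i₁ h01.symm]
      · simp [h01]
        ring
      · rintro j ⟨h0, h1⟩
        simp [h0, h1]
    · simp [add_mul, Finset.sum_add_distrib]
  · refine Finset.sum_congr rfl fun j _ => ?_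
    split_ifs <;> simp

/-- Strict row diagonal dominance. In row `i₀` the entry `A α` is at most `d`, so the off-diagonal
sum is at most `2d - 1 < A`; in the other rows it is at most `2(d - 1)`. -/
lemma perturbedMatrix_det_ne_zero {d : ℕ} {A α : ℝ} (hA : A = 2 * d) (hα : 0 ≤ α)
    (hα' : α ≤ 1 / 2) {i₀ i₁ : Fin d} (h01 : i₁ ≠ i₀) (t : Fin d → Fin d → I) :
    (perturbedMatrix A α i₀ i₁ t).det ≠ 0 := by
  have hd : (1 : ℝ) ≤ d := by exact_mod_cast i₀.pos
  have hcard : ∀ k : Fin d, (((Finset.univ.erase k).card : ℕ) : ℝ) = d - 1 := fun k => by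
    rw [Finset.card_erase_of_mem (Finset.mem_univ k), Finset.card_fin, Nat.cast_sub k.pos]
    simp
  refine det_ne_zero_of_sum_row_lt_diag fun k => ?_
  have ht0 : ∀ j, 0 ≤ (t k j : ℝ) := fun j => (t k j).2.1
  have ht1 : ∀ j, (t k j : ℝ) ≤ 1 := fun j => (t k j).2.2
  by_cases hk : k = i₀
  · subst hk
    calc ∑ j ∈ Finset.univ.erase k, ‖perturbedMatrix A α k i₁ t k j‖
        ≤ ∑ j ∈ Finset.univ.erase k, (1 + if j = i₁ then (d : ℝ) else 0) := by
          refine Finset.sum_le_sum fun j hj => ?_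
          have hjk : j ≠ k := Finset.ne_of_mem_erase hj
          by_cases h1 : j = i₁
          · simp only [perturbedMatrix, h1, h01, if_true, if_false, or_true, and_self, mul_zero,
              add_zero, norm_neg, Real.norm_eq_abs]
            rw [abs_of_nonneg (by rw [hA]; positivity), hA]
            nlinarith
          · simp only [perturbedMatrix, h1, hjk, if_true, if_false, or_self, and_false, mul_one,
              zero_add, add_zero, Real.norm_eq_abs]
            rw [abs_of_nonneg (ht0 j)]
            exact ht1 j
      _ = (d - 1) + d := by
          rw [Finset.sum_add_distrib, Finset.sum_const, nsmul_one, hcard, Finset.sum_ite_eq',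
            if_pos (Finset.mem_erase.2 ⟨h01, Finset.mem_univ _⟩)]
      _ < ‖perturbedMatrix A α k i₁ t k k‖ := by
          simp only [perturbedMatrix, if_true, true_or, and_self, mul_zero, add_zero,
            Real.norm_eq_abs]
          rw [abs_of_nonneg (by rw [hA]; positivity), hA]
          linarith
  · calc ∑ j ∈ Finset.univ.erase k, ‖perturbedMatrix A α i₀ i₁ t k j‖
        ≤ ∑ j ∈ Finset.univ.erase k, (2 : ℝ) := by
          refine Finset.sum_le_sum fun j hj => ?_
          have hjk : j ≠ k := Finset.ne_of_mem_erase hj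
          simp only [perturbedMatrix, hk, hjk, if_false, false_and, zero_add, mul_one,
            Real.norm_eq_abs]
          rw [abs_of_nonneg (by linarith [ht0 j])]
          linarith [ht1 j]
      _ = 2 * (d - 1) := by rw [Finset.sum_const, nsmul_eq_mul, hcard]; ring
      _ < ‖perturbedMatrix A α i₀ i₁ t k k‖ := by
          simp only [perturbedMatrix, hk, if_true, if_false, false_and, mul_one,
            Real.norm_eq_abs]
          rw [abs_of_nonneg (by rw [hA]; linarith [ht0 k]), hA]
          linarith [ht0 k]

/-- Entries at least `1` prevent cancellation at the special points, whose coordinates share a sign.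
-/
lemma perturbedMatrix_bounds {d : ℕ} {A : ℝ} (hA : 0 ≤ A) (α : ℝ) {i₀ i₁ : Fin d}
    (t : Fin d → Fin d → I) {i : Fin d} (hi : i ≠ i₀) (j : Fin d) :
    1 ≤ perturbedMatrix A α i₀ i₁ t i j ∧ perturbedMatrix A α i₀ i₁ t i j ≤ A + 2 := by
  have ht0 : 0 ≤ (t i j : ℝ) := (t i j).2.1
  have ht1 : (t i j : ℝ) ≤ 1 := (t i j).2.2
  simp only [perturbedMatrix, hi, if_false, false_and, mul_one]
  split_ifs <;> constructor <;> linarith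

/-- As `p ≤ q`, the norm is `|m| q`. Row `i₀` gives about `|m| q^(-s)` and each other row about `|m|
q`; passing to a multiple only helps the lower bound. -/
lemma prod_special_bounds {d : ℕ} {A α : ℝ} (hA : 2 ≤ A) {i₀ i₁ : Fin d} (h01 : i₁ ≠ i₀)
    (t : Fin d → Fin d → I) {s : ℝ} (hs : 0 ≤ s) {p q : ℕ} {m : ℤ} (hm : m ≠ 0) (hq : 0 < q)
    (hpq : p ≤ q)
    (hlow : 1 / 2 * (q : ℝ) ^ (-s) ≤ |p - α * q|) (hup : |p - α * q| ≤ 2 * (q : ℝ) ^ (-s))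
    (z : Fin d → ℤ) (h0 : z i₀ = m * p) (h1 : z i₁ = m * q)
    (hz : ∀ j, j ≠ i₀ → j ≠ i₁ → z j = 0) :
    ‖z‖ ^ (-s + (d - 1 : ℕ)) ≤ ∏ i, |∑ j, perturbedMatrix A α i₀ i₁ t i j * z j| ∧
    (m = 1 → ∏ i, |∑ j, perturbedMatrix A α i₀ i₁ t i j * z j| ≤
      2 * A * (2 * (A + 2)) ^ (d - 1) * ‖z‖ ^ (-s + (d - 1 : ℕ))) := by
  have hq' : (0 : ℝ) < q := by exact_mod_cast hq
  have hpq' : (p : ℝ) ≤ q := by exact_mod_cast hpq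
  have hm' : (1 : ℝ) ≤ |(m : ℝ)| := by exact_mod_cast Int.one_le_abs hm
  set N := |(m : ℝ)| * q with hN
  have hN0 : 0 < N := by positivity
  have hqN : (q : ℝ) ≤ N := by rw [hN]; nlinarith
  have hnorm : ‖z‖ = N := by
    refine le_antisymm ((pi_norm_le_iff_of_nonneg hN0.le).2 fun j => ?_) ?_
    · rw [Int.norm_eq_abs]
      by_cases hj0 : j = i₀
      · rw [hj0, h0]
        push_cast
        rw [abs_mul, Nat.abs_cast, hN]
        gcongr
      by_cases hj1 : j = i₁
      · rw [hj1, h1]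
        push_cast
        rw [abs_mul, Nat.abs_cast]
      · rw [hz j hj0 hj1]
        simpa using hN0.le
    · refine le_trans (le_of_eq ?_) (norm_le_pi_norm z i₁)
      rw [Int.norm_eq_abs, h1]
      push_cast
      rw [abs_mul, Nat.abs_cast]
  have hform : ∀ i, ∑ j, perturbedMatrix A α i₀ i₁ t i j * z j =
      m * (perturbedMatrix A α i₀ i₁ t i i₀ * p + perturbedMatrix A α i₀ i₁ t i i₁ * q) :=
      fun i => by
    rw [Fintype.sum_eq_add i₀ i₁ h01.symm fun j hj => by rw [hz j hj.1 hj.2]; simp, h0, h1]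
    push_cast
    ring
  have hform0 : |∑ j, perturbedMatrix A α i₀ i₁ t i₀ j * z j| =
      A * (|(m : ℝ)| * |p - α * q|) := by
    have : ∑ j, perturbedMatrix A α i₀ i₁ t i₀ j * z j = A * (m * (p - α * q)) := by
      rw [hform]
      simp [perturbedMatrix, h01]
      ring
    rw [this, abs_mul, abs_mul, abs_of_nonneg (by linarith : 0 ≤ A)]
  have hformi : ∀ i ∈ Finset.univ.erase i₀,
      N ≤ |∑ j, perturbedMatrix A α i₀ i₁ t i j * z j| ∧
      |∑ j, perturbedMatrix A α i₀ i₁ t i j * z j| ≤ 2 * (A + 2) * N := fun i hi => by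
    have hi' := Finset.ne_of_mem_erase hi
    obtain ⟨a1, a2⟩ := perturbedMatrix_bounds (by linarith : 0 ≤ A) α (i₁ := i₁) t hi' i₀
    obtain ⟨b1, b2⟩ := perturbedMatrix_bounds (by linarith : 0 ≤ A) α (i₁ := i₁) t hi' i₁
    set a := perturbedMatrix A α i₀ i₁ t i i₀
    set b := perturbedMatrix A α i₀ i₁ t i i₁
    have hp0 : (0 : ℝ) ≤ p := by positivity
    have hnn : 0 ≤ a * p + b * q := by positivity
    rw [hform, abs_mul, abs_of_nonneg hnn, hN]
    constructor
    · gcongr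
      nlinarith
    · have : a * p + b * q ≤ 2 * (A + 2) * q := by nlinarith
      calc |(m : ℝ)| * (a * p + b * q) ≤ |(m : ℝ)| * (2 * (A + 2) * q) := by gcongr
        _ = _ := by ring
  have hcard : (Finset.univ.erase i₀).card = d - 1 := by simp
  have hpw : N ^ (-s + (d - 1 : ℕ)) = N ^ (-s) * N ^ (d - 1) := by
    rw [Real.rpow_add hN0, Real.rpow_natCast]
  rw [hnorm, ← Finset.mul_prod_erase _ _ (Finset.mem_univ i₀), hform0, hpw]
  constructor
  · refine mul_le_mul ?_ ?_ (by positivity) (by positivity)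
    · have h2 : N ^ (-s) ≤ (q : ℝ) ^ (-s) :=
        Real.rpow_le_rpow_of_nonpos hq' hqN (by linarith)
      have h3 : 0 ≤ (q : ℝ) ^ (-s) := by positivity
      have h4 : |(p : ℝ) - α * q| ≤ |(m : ℝ)| * |p - α * q| :=
        le_mul_of_one_le_left (abs_nonneg _) hm'
      nlinarith
    · rw [← hcard, ← Finset.prod_const]
      exact Finset.prod_le_prod (fun _ _ => hN0.le) fun i hi => (hformi i hi).1
  · rintro rfl
    have hNq : N = q := by simp [hN]
    have h5 : ∏ i ∈ Finset.univ.erase i₀, |∑ j, perturbedMatrix A α i₀ i₁ t i j * z j| ≤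
        (2 * (A + 2) * N) ^ (d - 1) := by
      rw [← hcard, ← Finset.prod_const]
      exact Finset.prod_le_prod (fun _ _ => abs_nonneg _) fun i hi => (hformi i hi).2
    calc _ ≤ A * (2 * (q : ℝ) ^ (-s)) * (2 * (A + 2) * N) ^ (d - 1) := by
          have h6 : |((1 : ℤ) : ℝ)| * |p - α * q| ≤ 2 * (q : ℝ) ^ (-s) := by simpa using hup
          gcongr ?_ * ?_
          exact mul_le_mul_of_nonneg_left h6 (by linarith)
      _ = _ := by rw [hNq, mul_pow]; ring

lemma real_mem_spectrum {d : ℕ} (hd : 3 ≤ d) {w : ℝ} (hw : 9 / 4 ≤ w) :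
    (w : EReal) ∈ spectrum d := by
  have hd3 : (3 : ℝ) ≤ d := by exact_mod_cast hd
  -- Chosen so that `-s + (d - 1) = -(w d)`.
  set s : ℝ := w * d + d - 1 with hs
  have hs1 : 1 ≤ s := by nlinarith
  have hexp : -s + (d - 1 : ℕ) = -(w * d) := by
    rw [Nat.cast_sub (by omega), hs]
    push_cast
    ring
  obtain ⟨α, p, q, hα0, hα1, hmono, hq0, hpq, happ, hother⟩ :=
    exists_real_with_approximations hs1
  let i₀ : Fin d := ⟨0, by omega⟩
  let i₁ : Fin d := ⟨1, by omega⟩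
  have h01 : i₁ ≠ i₀ := by simp [i₀, i₁]
  set A : ℝ := 2 * d with hA
  have hA2 : 2 ≤ A := by linarith
  obtain ⟨t, c, hc, hrows⟩ := exists_rows_lower_bound hd w hw i₀ i₁ (fun i z =>
    if i = i₀ then A * (z i₀ - α * z i₁) else A * z i + ∑ j, (z j : ℝ))
  obtain ⟨b, hb⟩ := exists_basis_of_det_ne_zero _ (perturbedMatrix_det_ne_zero hA hα0 hα1 h01 t)
  refine mem_spectrum_of_basis (by omega) b w (min c 1) (2 * A * (2 * (A + 2)) ^ (d - 1))
    (by linarith) (by positivity) (by positivity) (fun z hz => ?_) ?_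
  · simp only [hb]
    have hzn : 0 ≤ ‖z‖ ^ (-(w * d)) := by positivity
    -- Multiples of the special points are bounded directly; all other points fall under the
    -- averaging bound.
    by_cases hspec : (∀ j, j ≠ i₀ → j ≠ i₁ → z j = 0) ∧
        ∃ (k : ℕ) (m : ℤ), z i₀ = m * p k ∧ z i₁ = m * q k
    · obtain ⟨hrest, k, m, h0, h1⟩ := hspec
      have hm : m ≠ 0 := by
        rintro rfl
        refine hz (funext fun j => ?_)
        by_cases hj0 : j = i₀
        · simp [hj0, h0]
        by_cases hj1 : j = i₁
        · simp [hj1, h1]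
        · exact hrest j hj0 hj1
      refine le_trans ?_ (prod_special_bounds hA2 h01 t (by linarith) hm (hq0 k) (hpq k)
        (happ k).1 (happ k).2 z h0 h1 hrest).1
      rw [hexp]
      exact mul_le_of_le_one_left hzn (min_le_right _ _)
    · simp only [perturbedMatrix_sum_mul A α h01]
      refine le_trans (mul_le_mul_of_nonneg_right (min_le_left _ _) hzn)
        (hrows z hz fun hrest => ?_)
      have hne : z i₀ ≠ 0 ∨ z i₁ ≠ 0 := by
        by_contra! h
        refine hz (funext fun j => ?_)
        by_cases hj0 : j = i₀
        · rw [hj0]; exact h.1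
        by_cases hj1 : j = i₁
        · rw [hj1]; exact h.2
        · exact hrest j hj0 hj1
      have hcoord : ∀ j, |(z j : ℝ)| ≤ ‖z‖ := fun j => by
        rw [← Int.norm_eq_abs]
        exact norm_le_pi_norm z j
      have h32 := (hother (z i₀) (z i₁) hne).resolve_left (fun h => hspec ⟨hrest, h⟩)
        ‖z‖ (hcoord i₀) (hcoord i₁)
      rw [if_pos rfl, abs_mul, abs_of_nonneg (by linarith : 0 ≤ A)]
      have hX : 0 ≤ ‖z‖ ^ 2 * |(z i₀ : ℝ) - α * z i₁| := by positivity
      nlinarith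
  · let f : ℕ → Fin d → ℤ := fun k j => if j = i₀ then p k else if j = i₁ then q k else 0
    have hf0 : ∀ k, f k i₀ = p k := fun k => by simp [f]
    have hf1 : ∀ k, f k i₁ = q k := fun k => by simp [f, h01]
    refine Set.infinite_of_injective_forall_mem (f := f) (fun k l h => ?_) fun k => ⟨?_, ?_⟩
    · have h' := congrFun h i₁
      rw [hf1, hf1] at h'
      exact hmono.injective (by exact_mod_cast h')
    · intro h
      have h' := congrFun h i₁
      rw [hf1, Pi.zero_apply] at h'
      exact (hq0 k).ne' (by exact_mod_cast h')
    · simp only [hb]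
      rw [← hexp]
      exact (prod_special_bounds hA2 h01 t (by linarith) one_ne_zero (hq0 k) (hpq k)
        (happ k).1 (happ k).2 (f k) (by rw [hf0, one_mul]) (by rw [hf1, one_mul])
        fun j hj0 hj1 => by simp [f, hj0, hj1]).2 rfl

end LatticeExponent

theorem theorem1 (d : ℕ) (hd : 3 ≤ d) :
    Set.Icc ((3 - (d : ℝ) / ((d : ℝ) - 1) ^ 2 : ℝ) : EReal) ⊤ ⊆ LatticeExponent.spectrum d := by
  rintro x ⟨hx, -⟩
  induction x with
  | bot => exact absurd (le_bot_iff.1 hx) (EReal.coe_ne_bot _)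
  | top => exact LatticeExponent.top_mem_spectrum (by omega)
  | coe w =>
    rw [EReal.coe_le_coe_iff] at hx
    refine LatticeExponent.real_mem_spectrum hd (le_trans ?_ hx)
    have hd3 : (3 : ℝ) ≤ d := by exact_mod_cast hd
    -- Equality holds at `d = 3`, whence the threshold `9/4 = 3 - 3/4`.
    have h : (d : ℝ) / ((d : ℝ) - 1) ^ 2 ≤ 3 / 4 := by
      rw [div_le_iff₀ (by nlinarith)]
      nlinarith
    linarith
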